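/- **Definitions.** A *restriction category* is a category $\mathbf C$ with an operator assigning to each $f:X\to Y$ a morphism $\bar f:X\to X$ such that (R1) $f\circ\bar f=f$; (R2) $\bar f\circ\bar g=\bar g\circ\bar f$ for $f,g$ with the same domain; (R3) $\overline{f\circ\bar g}=\bar f\circ\bar g$ for $f,g$ with the same domain; (R4) $\bar h\circ f=f\circ\overline{h\circ f}$ for $f:X\to Y$, $h:Y\to Z$. A morphism $f:X\to Y$ is a *partial isomorphism* if there is a unique $f^\circ:Y\to X$ (its *partial inverse*) with $f\circ f^\circ=\overline{f^\circ}$ and $f^\circ\circ f=\bar f$. An *inverse category* is a restriction category in which every morphism is a partial isomorphism. A *dagger structure* on a category assigns to each $f:X\to Y$ a morphism $f^\dagger:Y\to X$ with $1_X^\dagger=1_X$, $(g\circ f)^\dagger=f^\dagger\circ g^\dagger$ and $f^{\dagger\dagger}=f$. A measure $\mu$ on $(X,\Sigma)$ is *localizable* if every set of infinite measure contains a measurable set of finite nonzero measure and every family of measurable sets has an essential supremum (a least upper bound in $\Sigma$ modulo null sets). $\mathbf{LocMeas}$ is the category whose objects are triples $(X,\Sigma,\mathcal N)$ with $\mathcal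 N$ the ideal of negligible sets (subsets of measurable sets of measure zero) of some localizable measure on $(X,\Sigma)$, and whose morphisms are the almost-everywhere equivalence classes of non-singular measurable maps (measurable maps $\phi:X\to Y$ such that $\phi^{-1}[F]$ is null for every null measurable $F\subseteq Y$). Let $\mathcal M$ be the class of stable monics of $\mathbf{LocMeas}$, i.e. the monomorphisms that have a pullback along every morphism into their codomain; it contains the isomorphisms and is closed under composition and under pullback along arbitrary morphisms. $(\mathbf{LocMeas},\mathcal M)$ is the category with the objects of $\mathbf{LocMeas}$ and the morphisms in $\mathcal M$. $\mathrm{Par}((\mathbf{LocMeas},\mathcal M),\mathcal M)$ is the restriction category with the same objects, whose morphisms $X\to Y$ are spans $(m,f)$, $X\xleftarrow{m}X'\xrightarrow{f}Y$ with $m,f\in\mathcal M$, modulo isomorphism of $X'$, composed by pullback, with $\overline{(m,f)}=(m,m)$. **Proposition.** (1) Every inverse category carries a dagger structure given by $f^\dagger=f^\circ$ for every morphism $f$. (2) In particular, $\mathrm{Par}((\mathbf{LocMeas},\mathcal M),\mathcal M)$ is an inverse category, and hence a dagger category with $f^\dagger=f^\circ$. -/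

import Mathlib

open CategoryTheory CategoryTheory.Limits MeasureTheory

universe u v w

/-! ### Restriction categories, inverse categories, dagger categories

Composition is written in diagrammatic order: `f ≫ g` is `g ∘ f`. -/

/-- A restriction structure on a category: an operator `f ↦ bar f` sending `f : X ⟶ Y` to a
restriction idempotent `bar f : X ⟶ X`, subject to the four Cockett–Lack axioms. -/
structure RestrictionStructure (C : Type u) [Category.{v} C] where
  bar : ∀ {X Y : C}, (X ⟶ Y) → (X ⟶ X)
  bar_comp_self : ∀ {X Y : C} (f : X ⟶ Y), bar f ≫ f = f
  bar_comm : ∀ {X Y Z : C} (f : X ⟶ Y) (g : X ⟶ Z), bar f ≫ bar g = bar g ≫ bar f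
  bar_bar_comp : ∀ {X Y Z : C} (f : X ⟶ Y) (g : X ⟶ Z), bar (bar g ≫ f) = bar g ≫ bar f
  comp_bar : ∀ {X Y Z : C} (f : X ⟶ Y) (h : Y ⟶ Z), f ≫ bar h = bar (f ≫ h) ≫ f

namespace RestrictionStructure

variable {C : Type u} [Category.{v} C] (R : RestrictionStructure C)

/-- `g` is a partial inverse of `f`: `f ∘ g` is the restriction idempotent of `g` and `g ∘ f` is
the restriction idempotent of `f`. -/
def IsPartialInverse {X Y : C} (f : X ⟶ Y) (g : Y ⟶ X) : Prop :=
  g ≫ f = R.bar g ∧ f ≫ g = R.bar f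

/-- `f` is a partial isomorphism: it has a unique partial inverse. -/
def IsPartialIso {X Y : C} (f : X ⟶ Y) : Prop :=
  ∃! g : Y ⟶ X, R.IsPartialInverse f g

/-- An inverse category is a restriction category all of whose morphisms are partial
isomorphisms. -/
def IsInverseCategory : Prop :=
  ∀ {X Y : C} (f : X ⟶ Y), R.IsPartialIso f

/-- The partial inverse `f°` of a morphism `f` of an inverse category. -/
noncomputable def partialInverse {R : RestrictionStructure C} (h : R.IsInverseCategory)
    {X Y : C} (f : X ⟶ Y) : Y ⟶ X :=
  (h f).choose

end RestrictionStructure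

/-- A dagger structure on a category: a contravariant, identity-on-objects, involutive
endofunctor. -/
structure DaggerStructure (C : Type u) [Category.{v} C] where
  dag : ∀ {X Y : C}, (X ⟶ Y) → (Y ⟶ X)
  dag_id : ∀ X : C, dag (𝟙 X) = 𝟙 X
  dag_comp : ∀ {X Y Z : C} (f : X ⟶ Y) (g : Y ⟶ Z), dag (f ≫ g) = dag g ≫ dag f
  dag_dag : ∀ {X Y : C} (f : X ⟶ Y), dag (dag f) = f

/-! ### Stable systems of monics (`M`-categories) -/

/-- `M` is a stable system of monics: it consists of monomorphisms, contains the isomorphisms, is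
closed under composition, and every pullback of a morphism in `M` along an arbitrary morphism
exists and is in `M`. A category with such an `M` is an `M`-category. -/
class IsStableSystem {C : Type u} [Category.{v} C] (M : MorphismProperty C) : Prop where
  mono : ∀ {X Y : C} {m : X ⟶ Y}, M m → Mono m
  iso_mem : ∀ {X Y : C} (e : X ≅ Y), M e.hom
  comp_mem : ∀ {X Y Z : C} (m : X ⟶ Y) (n : Y ⟶ Z), M m → M n → M (m ≫ n)
  pullback_mem : ∀ {X Y Z : C} (m : X ⟶ Y) (f : Z ⟶ Y), M m →
    ∃ (P : C) (a : P ⟶ X) (b : P ⟶ Z), IsPullback a b m f ∧ M b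

instance {C : Type u} [Category.{v} C] (M : MorphismProperty C) [h : IsStableSystem M] :
    M.IsMultiplicative where
  id_mem X := h.iso_mem (Iso.refl X)
  comp_mem := h.comp_mem

/-- A base change of a morphism of a stable system lies in the system, for every choice of the
pullback square. -/
theorem IsStableSystem.of_isPullback {C : Type u} [Category.{v} C] {M : MorphismProperty C}
    [IsStableSystem M] {P X Y Z : C} {a : P ⟶ X} {b : P ⟶ Z} {m : X ⟶ Y} {f : Z ⟶ Y}
    (sq : IsPullback a b m f) (hm : M m) : M b := by
  obtain ⟨Q, a', b', sq', hb'⟩ := IsStableSystem.pullback_mem m f hm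
  have h := IsStableSystem.comp_mem _ _
    (IsStableSystem.iso_mem (M := M) (sq.isoIsPullback _ _ sq')) hb'
  simpa using h

/-- The stable monics of a category: the monomorphisms that admit a pullback along every morphism
into their codomain. If all these pullbacks exist, this is the class of all monomorphisms. -/
def stableMonics (C : Type u) [Category.{v} C] : MorphismProperty C :=
  fun _ Y m => Mono m ∧ ∀ (Z : C) (f : Z ⟶ Y), HasPullback m f

instance stableMonics_isStableSystem (C : Type u) [Category.{v} C] :
    IsStableSystem (stableMonics C) where
  mono h := h.1
  iso_mem e := ⟨inferInstance, fun _ f => hasPullback_of_left_iso e.hom f⟩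
  comp_mem m n hm hn := by
    have := hm.1
    have := hn.1
    refine ⟨mono_comp m n, fun _ f => ?_⟩
    have := hn.2 _ f
    have := hm.2 _ (pullback.fst n f)
    exact ((IsPullback.of_hasPullback m (pullback.fst n f)).flip.paste_horiz
      (IsPullback.of_hasPullback n f).flip).flip.hasPullback
  pullback_mem m f hm := by
    have := hm.1
    have := hm.2 _ f
    refine ⟨pullback m f, pullback.fst m f, pullback.snd m f, IsPullback.of_hasPullback m f,
      inferInstance, fun W g => ?_⟩
    have := hm.2 _ (g ≫ f)
    exact (IsPullback.of_bot' (IsPullback.of_hasPullback m (g ≫ f)).flip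
      (IsPullback.of_hasPullback m f).flip).flip.hasPullback

/-- In the category `(C, M)` of objects of `C` and morphisms in `M`, the class of all morphisms is
a stable system of monics. -/
instance top_isStableSystem_wide {C : Type u} [Category.{v} C] (M : MorphismProperty C)
    [hM : IsStableSystem M] : IsStableSystem (⊤ : MorphismProperty (WideSubcategory M)) where
  mono {X Y m} _ := by
    refine ⟨fun g h e => ?_⟩
    have := hM.mono m.property
    apply WideSubcategory.hom_ext
    have e' := congrArg (fun t => t.hom) e
    exact (cancel_mono m.hom).1 e'
  iso_mem _ := trivial
  comp_mem _ _ _ _ := trivial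
  pullback_mem {X Y Z} m f _ := by
    obtain ⟨P, a, b, sq, hb⟩ := hM.pullback_mem m.hom f.hom m.property
    have ha : M a := IsStableSystem.of_isPullback sq.flip f.property
    refine ⟨⟨P⟩, ⟨a, ha⟩, ⟨b, hb⟩, ⟨⟨WideSubcategory.hom_ext _ sq.w⟩, ⟨?_⟩⟩, trivial⟩
    have := hM.mono ha
    have key : ∀ {W : C} (l : W ⟶ P), M (l ≫ a) → M l := by
      intro W l hl
      refine IsStableSystem.of_isPullback (a := 𝟙 W) (m := l ≫ a) (f := a) ?_ hl
      refine IsPullback.of_isLimit' ⟨by simp⟩ (PullbackCone.IsLimit.mk _ (fun s => s.fst)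
        (fun s => by simp) (fun s => ?_) (fun s t h1 _ => by simpa using h1))
      rw [← cancel_mono a, Category.assoc, s.condition]
    refine PullbackCone.IsLimit.mk _
      (fun s => ⟨sq.lift s.fst.hom s.snd.hom (congrArg (fun t => t.hom) s.condition),
        key _ ?_⟩)
      (fun s => ?_) (fun s => ?_) (fun s t h1 h2 => ?_)
    · rw [IsPullback.lift_fst]
      exact s.fst.property
    · exact WideSubcategory.hom_ext _ (sq.lift_fst _ _ _)
    · exact WideSubcategory.hom_ext _ (sq.lift_snd _ _ _)
    · apply WideSubcategory.hom_ext
      refine sq.hom_ext ?_ ?_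
      · rw [sq.lift_fst]
        exact congrArg (fun t => t.hom) h1
      · rw [sq.lift_snd]
        exact congrArg (fun t => t.hom) h2

/-! ### The category of partial maps `Par(C, M)` -/

/-- A span `X ⟵ dom ⟶ Y` whose left leg is in `M`. -/
structure PartialSpan {C : Type u} [Category.{v} C] (M : MorphismProperty C) (X Y : C) where
  dom : C
  left : dom ⟶ X
  right : dom ⟶ Y
  left_mem : M left

/-- Two spans are equivalent if they are related by an isomorphism of their domains. -/
def PartialSpan.setoid {C : Type u} [Category.{v} C] (M : MorphismProperty C) (X Y : C) :
    Setoid (PartialSpan M X Y) where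
  r S T := ∃ e : S.dom ≅ T.dom, e.hom ≫ T.left = S.left ∧ e.hom ≫ T.right = S.right
  iseqv :=
    { refl := fun S => ⟨Iso.refl _, by simp, by simp⟩
      symm := by
        rintro S T ⟨e, h1, h2⟩
        exact ⟨e.symm, by simp [← h1], by simp [← h2]⟩
      trans := by
        rintro S T U ⟨e, h1, h2⟩ ⟨e', h3, h4⟩
        exact ⟨e ≪≫ e', by simp [h1, h3], by simp [h2, h4]⟩ }

/-- The objects of `Par(C, M)` are those of `C`. -/
structure Par {C : Type u} [Category.{v} C] (M : MorphismProperty C) where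
  obj : C

namespace Par

variable {C : Type u} [Category.{v} C] {M : MorphismProperty C}

/-- The morphisms of `Par(C, M)`: spans with left leg in `M`, up to equivalence. -/
def Hom (M : MorphismProperty C) (X Y : C) : Type (max u v) :=
  Quotient (PartialSpan.setoid M X Y)

/-- The class of a span. -/
def ofSpan {X Y : C} (S : PartialSpan M X Y) : Hom M X Y :=
  Quotient.mk (PartialSpan.setoid M X Y) S

theorem ofSpan_eq {X Y : C} {S T : PartialSpan M X Y} (e : S.dom ≅ T.dom)
    (h1 : e.hom ≫ T.left = S.left) (h2 : e.hom ≫ T.right = S.right) : ofSpan S = ofSpan T :=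
  Quotient.sound ⟨e, h1, h2⟩

variable [hM : IsStableSystem M]

/-- The composite of two spans along a pullback square. -/
def compAlong {X Y Z : C} (S : PartialSpan M X Y) (T : PartialSpan M Y Z) {P : C}
    {b : P ⟶ T.dom} {a : P ⟶ S.dom} (sq : IsPullback b a T.left S.right) : PartialSpan M X Z where
  dom := P
  left := a ≫ S.left
  right := b ≫ T.right
  left_mem := hM.comp_mem _ _ (IsStableSystem.of_isPullback sq T.left_mem) S.left_mem

theorem compAlong_congr {X Y Z : C} {S S' : PartialSpan M X Y} {T T' : PartialSpan M Y Z}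
    (hS : (PartialSpan.setoid M X Y).r S S') (hT : (PartialSpan.setoid M Y Z).r T T')
    {P : C} {b : P ⟶ T.dom} {a : P ⟶ S.dom} (sq : IsPullback b a T.left S.right)
    {P' : C} {b' : P' ⟶ T'.dom} {a' : P' ⟶ S'.dom} (sq' : IsPullback b' a' T'.left S'.right) :
    ofSpan (compAlong S T sq) = ofSpan (compAlong S' T' sq') := by
  obtain ⟨e, h1, h2⟩ := hS
  obtain ⟨d, k1, k2⟩ := hT
  have sq2 : IsPullback (b ≫ d.hom) (a ≫ e.hom) T'.left S'.right :=
    sq.of_iso (Iso.refl _) d e (Iso.refl _) (by simp) (by simp) (by simp [k1]) (by simp [h2])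
  refine ofSpan_eq (sq2.isoIsPullback _ _ sq') ?_ ?_
  · simp [compAlong, h1]
  · simp [compAlong, k2]

/-- The composite of two spans along a chosen pullback square. -/
noncomputable def compSpan {X Y Z : C} (S : PartialSpan M X Y) (T : PartialSpan M Y Z) :
    PartialSpan M X Z :=
  compAlong S T
    (hM.pullback_mem T.left S.right T.left_mem).choose_spec.choose_spec.choose_spec.1

/-- Composition in `Par(C, M)`. -/
noncomputable def comp {X Y Z : C} (f : Hom M X Y) (g : Hom M Y Z) : Hom M X Z :=
  Quotient.lift₂ (fun S T => ofSpan (compSpan S T))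
    (fun _ _ _ _ h1 h2 => compAlong_congr h1 h2 _ _) f g

theorem comp_ofSpan {X Y Z : C} (S : PartialSpan M X Y) (T : PartialSpan M Y Z) {P : C}
    {b : P ⟶ T.dom} {a : P ⟶ S.dom} (sq : IsPullback b a T.left S.right) :
    comp (ofSpan S) (ofSpan T) = ofSpan (compAlong S T sq) :=
  compAlong_congr ((PartialSpan.setoid M _ _).refl _) ((PartialSpan.setoid M _ _).refl _) _ _

/-- The identity span. -/
def idSpan (X : C) : PartialSpan M X X := ⟨X, 𝟙 X, 𝟙 X, hM.iso_mem (Iso.refl X)⟩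

theorem id_comp {X Y : C} (f : Hom M X Y) : comp (ofSpan (idSpan X)) f = f := by
  obtain ⟨S, rfl⟩ : ∃ S, ofSpan S = f := Quotient.exists_rep f
  have sq : IsPullback (𝟙 S.dom) S.left S.left (𝟙 X) := IsPullback.of_horiz_isIso ⟨by simp⟩
  rw [comp_ofSpan (idSpan X) S sq]
  exact ofSpan_eq (Iso.refl _) (by simp [compAlong, idSpan]) (by simp [compAlong])

theorem comp_id {X Y : C} (f : Hom M X Y) : comp f (ofSpan (idSpan Y)) = f := by
  obtain ⟨S, rfl⟩ : ∃ S, ofSpan S = f := Quotient.exists_rep f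
  have sq : IsPullback S.right (𝟙 S.dom) (𝟙 Y) S.right := IsPullback.of_vert_isIso ⟨by simp⟩
  rw [comp_ofSpan S (idSpan Y) sq]
  exact ofSpan_eq (Iso.refl _) (by simp [compAlong]) (by simp [compAlong, idSpan])

theorem assoc {W X Y Z : C} (f : Hom M W X) (g : Hom M X Y) (h : Hom M Y Z) :
    comp (comp f g) h = comp f (comp g h) := by
  obtain ⟨S, rfl⟩ : ∃ S, ofSpan S = f := Quotient.exists_rep f
  obtain ⟨T, rfl⟩ : ∃ S, ofSpan S = g := Quotient.exists_rep g
  obtain ⟨U, rfl⟩ : ∃ S, ofSpan S = h := Quotient.exists_rep h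
  obtain ⟨P, b, a, sq, ha⟩ := hM.pullback_mem T.left S.right T.left_mem
  obtain ⟨Q, d, c, sq', hc⟩ := hM.pullback_mem U.left T.right U.left_mem
  obtain ⟨V, k, l, sq'', hl⟩ := hM.pullback_mem c b hc
  have s1 : IsPullback (k ≫ d) l U.left (compAlong S T sq).right :=
    (sq''.flip.paste_vert sq'.flip).flip
  have s2 : IsPullback k (l ≫ a) (compAlong T U sq').left S.right := by
    exact (sq''.flip.paste_horiz sq.flip).flip
  rw [comp_ofSpan _ _ sq, comp_ofSpan _ _ sq', comp_ofSpan _ _ s1, comp_ofSpan _ _ s2]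
  exact ofSpan_eq (Iso.refl _) (by simp [compAlong]) (by simp [compAlong])

/-- The category `Par(C, M)`. -/
noncomputable instance category : Category.{max u v} (Par M) where
  Hom X Y := Hom M X.obj Y.obj
  id X := ofSpan (idSpan X.obj)
  comp f g := comp f g
  id_comp f := id_comp f
  comp_id f := comp_id f
  assoc f g h := assoc f g h

/-- The restriction of the class of `(m, f)` is the class of `(m, m)`. -/
def bar {X Y : C} (f : Hom M X Y) : Hom M X X :=
  Quotient.map' (s₁ := PartialSpan.setoid M X Y) (s₂ := PartialSpan.setoid M X X)
    (fun S => ⟨S.dom, S.left, S.left, S.left_mem⟩)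
    (fun _ _ ⟨e, h1, _⟩ => ⟨e, h1, h1⟩) f

/-- The restriction structure of `Par(C, M)`. -/
noncomputable def restriction (M : MorphismProperty C) [hM : IsStableSystem M] :
    RestrictionStructure (Par M) where
  bar f := bar (M := M) f
  bar_comp_self {X Y} f := by
    obtain ⟨S, rfl⟩ : ∃ S, ofSpan S = f := Quotient.exists_rep f
    have := hM.mono S.left_mem
    have sq : IsPullback (𝟙 S.dom) (𝟙 S.dom) S.left S.left := IsKernelPair.id_of_mono S.left
    refine (comp_ofSpan (⟨S.dom, S.left, S.left, S.left_mem⟩ : PartialSpan M _ _) S sq).trans ?_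
    exact ofSpan_eq (Iso.refl _) (by simp [compAlong]) (by simp [compAlong])
  bar_comm {X Y Z} f g := by
    obtain ⟨S, rfl⟩ : ∃ S, ofSpan S = f := Quotient.exists_rep f
    obtain ⟨T, rfl⟩ : ∃ S, ofSpan S = g := Quotient.exists_rep g
    obtain ⟨P, b, a, sq, ha⟩ := hM.pullback_mem T.left S.left T.left_mem
    refine (comp_ofSpan (⟨S.dom, S.left, S.left, S.left_mem⟩ : PartialSpan M _ _)
      ⟨T.dom, T.left, T.left, T.left_mem⟩ sq).trans ?_
    refine Eq.trans ?_ (comp_ofSpan (⟨T.dom, T.left, T.left, T.left_mem⟩ : PartialSpan M _ _)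
      ⟨S.dom, S.left, S.left, S.left_mem⟩ sq.flip).symm
    exact ofSpan_eq (Iso.refl _) (by simp [compAlong, sq.w]) (by simp [compAlong, sq.w])
  bar_bar_comp {X Y Z} f g := by
    obtain ⟨S, rfl⟩ : ∃ S, ofSpan S = f := Quotient.exists_rep f
    obtain ⟨T, rfl⟩ : ∃ S, ofSpan S = g := Quotient.exists_rep g
    obtain ⟨P, b, a, sq, ha⟩ := hM.pullback_mem S.left T.left S.left_mem
    refine (congrArg bar (comp_ofSpan (⟨T.dom, T.left, T.left, T.left_mem⟩ : PartialSpan M _ _)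
      S sq)).trans ?_
    refine Eq.trans ?_ (comp_ofSpan (⟨T.dom, T.left, T.left, T.left_mem⟩ : PartialSpan M _ _)
      ⟨S.dom, S.left, S.left, S.left_mem⟩ sq).symm
    exact ofSpan_eq (Iso.refl _) (by simp [compAlong]) (by simp [compAlong, sq.w])
  comp_bar {X Y Z} f h := by
    obtain ⟨S, rfl⟩ : ∃ S, ofSpan S = f := Quotient.exists_rep f
    obtain ⟨T, rfl⟩ : ∃ S, ofSpan S = h := Quotient.exists_rep h
    have := hM.mono S.left_mem
    obtain ⟨P, b, a, sq, ha⟩ := hM.pullback_mem T.left S.right T.left_mem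
    have sq' : IsPullback a (𝟙 P) S.left (a ≫ S.left) := by
      have h0 : IsPullback a (𝟙 P) (𝟙 S.dom) a := IsPullback.of_vert_isIso ⟨by simp⟩
      simpa using h0.paste_horiz (IsKernelPair.id_of_mono S.left)
    refine (comp_ofSpan S ⟨T.dom, T.left, T.left, T.left_mem⟩ sq).trans ?_
    refine Eq.trans ?_ (congrArg (fun t => comp (bar t) (ofSpan S))
      (comp_ofSpan S T sq)).symm
    refine Eq.trans ?_ (comp_ofSpan (⟨P, a ≫ S.left, a ≫ S.left, (compAlong S T sq).left_mem⟩ :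
      PartialSpan M _ _) S sq').symm
    exact ofSpan_eq (Iso.refl _) (by simp [compAlong]) (by simp [compAlong, sq.w])

end Par

/-! ### Localizable measurable spaces -/

/-- A measure is localizable if it is semi-finite and every family of measurable sets has an
essential supremum. -/
structure IsLocalizable {X : Type u} [MeasurableSpace X] (μ : Measure X) : Prop where
  semifinite : ∀ E : Set X, MeasurableSet E → μ E = ⊤ →
    ∃ F ⊆ E, MeasurableSet F ∧ 0 < μ F ∧ μ F < ⊤
  exists_essSup : ∀ 𝓔 : Set (Set X), (∀ E ∈ 𝓔, MeasurableSet E) →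
    ∃ H : Set X, MeasurableSet H ∧ (∀ E ∈ 𝓔, μ (E \ H) = 0) ∧
      ∀ G : Set X, MeasurableSet G → (∀ E ∈ 𝓔, μ (E \ G) = 0) → μ (H \ G) = 0

/-- A localizable measurable space `(X, Σ, 𝓝)`: a set with a σ-algebra and the null ideal `𝓝` of
some localizable measure on it. The measure itself is not part of the structure. In Mathlib,
`μ s = 0` for an arbitrary set `s` means that `s` is contained in a measurable set of measure
zero. -/
structure LocMeas : Type (u + 1) where
  carrier : Type u
  [meas : MeasurableSpace carrier]
  null : Set (Set carrier)
  exists_measure : ∃ μ : Measure carrier, IsLocalizable μ ∧ ∀ s, s ∈ null ↔ μ s = 0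

namespace LocMeas

attribute [instance] LocMeas.meas

theorem null_mono (X : LocMeas.{u}) {s t : Set X.carrier} (h : s ⊆ t) (ht : t ∈ X.null) :
    s ∈ X.null := by
  obtain ⟨μ, -, hμ⟩ := X.exists_measure
  rw [hμ] at ht ⊢
  exact measure_mono_null h ht

theorem null_union (X : LocMeas.{u}) {s t : Set X.carrier} (hs : s ∈ X.null) (ht : t ∈ X.null) :
    s ∪ t ∈ X.null := by
  obtain ⟨μ, -, hμ⟩ := X.exists_measure
  rw [hμ] at hs ht ⊢
  exact measure_union_null hs ht

theorem null_empty (X : LocMeas.{u}) : (∅ : Set X.carrier) ∈ X.null := by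
  obtain ⟨μ, -, hμ⟩ := X.exists_measure
  rw [hμ]
  exact measure_empty

theorem exists_measurable_null (X : LocMeas.{u}) {s : Set X.carrier} (hs : s ∈ X.null) :
    ∃ t, s ⊆ t ∧ MeasurableSet t ∧ t ∈ X.null := by
  obtain ⟨μ, -, hμ⟩ := X.exists_measure
  rw [hμ] at hs
  obtain ⟨t, h1, h2, h3⟩ := exists_measurable_superset_of_null hs
  exact ⟨t, h1, h2, (hμ t).2 h3⟩

/-- A non-singular (measure-zero-reflecting) measurable function. -/
structure NonSingularMap (X Y : LocMeas.{u}) where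
  toFun : X.carrier → Y.carrier
  measurable : Measurable toFun
  preimage_null : ∀ F, MeasurableSet F → F ∈ Y.null → toFun ⁻¹' F ∈ X.null

theorem NonSingularMap.preimage_mem_null {X Y : LocMeas.{u}} (f : NonSingularMap X Y)
    {s : Set Y.carrier} (hs : s ∈ Y.null) : f.toFun ⁻¹' s ∈ X.null := by
  obtain ⟨t, h1, h2, h3⟩ := Y.exists_measurable_null hs
  exact X.null_mono (Set.preimage_mono h1) (f.preimage_null t h2 h3)

/-- Almost everywhere equality of non-singular maps. -/
def NonSingularMap.aeSetoid (X Y : LocMeas.{u}) : Setoid (NonSingularMap X Y) where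
  r f g := {x | f.toFun x ≠ g.toFun x} ∈ X.null
  iseqv :=
    { refl := fun f => by simpa using X.null_empty
      symm := fun {f g} h => by simpa only [ne_comm] using h
      trans := fun {f g k} h1 h2 => by
        refine X.null_mono (fun x hx => ?_) (X.null_union h1 h2)
        by_cases h : f.toFun x = g.toFun x
        · exact Or.inr (fun h3 => hx (h.trans h3))
        · exact Or.inl h }

/-- The identity map. -/
def NonSingularMap.id (X : LocMeas.{u}) : NonSingularMap X X :=
  ⟨fun x => x, measurable_id, fun _ _ h => h⟩

/-- The composite `g ∘ f`. -/
def NonSingularMap.comp {X Y Z : LocMeas.{u}} (f : NonSingularMap X Y) (g : NonSingularMap Y Z) :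
    NonSingularMap X Z :=
  ⟨fun x => g.toFun (f.toFun x), g.measurable.comp f.measurable,
    fun F hF h => f.preimage_null _ (g.measurable hF) (g.preimage_null F hF h)⟩

/-- The category of localizable measurable spaces and almost everywhere equivalence classes of
non-singular measurable maps. -/
instance category : Category.{u} LocMeas.{u} where
  Hom X Y := Quotient (NonSingularMap.aeSetoid X Y)
  id X := Quotient.mk _ (NonSingularMap.id X)
  comp {X Y Z} f g := Quotient.map₂ (sa := NonSingularMap.aeSetoid X Y)
    (sb := NonSingularMap.aeSetoid Y Z) (sc := NonSingularMap.aeSetoid X Z) NonSingularMap.comp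
    (fun f f' hf g g' hg => by
      refine X.null_mono (fun x hx => ?_) (X.null_union hf (f.preimage_mem_null hg))
      by_cases h : f.toFun x = f'.toFun x
      · refine Or.inr (fun h2 => hx ?_)
        exact h2.trans (congrArg g'.toFun h)
      · exact Or.inl h) f g
  id_comp {X Y} f := by
    induction f using Quotient.inductionOn
    rfl
  comp_id {X Y} f := by
    induction f using Quotient.inductionOn
    rfl
  assoc {W X Y Z} f g h := by
    induction f using Quotient.inductionOn
    induction g using Quotient.inductionOn
    induction h using Quotient.inductionOn
    rfl

end LocMeas

/-- The category `(LocMeas, M)`: localizable measurable spaces and stable monics. -/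
abbrev MonicLocMeas : Type (u + 1) := WideSubcategory (stableMonics LocMeas.{u})

/-- `Par((LocMeas, M), M)`: localizable measurable spaces and partial monic maps, that is, spans of
stable monics up to equivalence. Its class of left legs is the class `M` of all morphisms of
`(LocMeas, M)`. -/
abbrev ParMonicLocMeas : Type (u + 1) := Par (⊤ : MorphismProperty MonicLocMeas.{u})

/-!
A partial inverse in a restriction category satisfies exactly the same equations as the morphism
it inverts, with the two roles exchanged, so `f°° = f` as soon as partial inverses are unique.
Uniqueness (`IsPartialInverse.unique`) always holds: if `g` and `g'` both invert `f`, then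
`g = bar g ≫ g'` and `g' = bar g' ≫ g`, and restriction idempotents commute. Hence a partial
inverse can be recognised by its two equations, and `(f ≫ g)° = g° ≫ f°` reduces to
`IsPartialInverse.comp`, a computation with the restriction axioms.

In `Par(C, ⊤)` over a category in which *all* morphisms form a stable system of monics, the right
leg of a span may also serve as a left leg. The span `(m, f)` then has the partial inverse
`(f, m)`: as `f` and `m` are monic, their kernel pairs are trivial, so the two composites are
`(m, m)` and `(f, f)`. This applies to `(LocMeas, M)`, whose morphisms are stable monics
by definition and form a stable system by `top_isStableSystem_wide`.
-/

/-! ### Partial inverses in a restriction category -/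

namespace RestrictionStructure

variable {C : Type u} [Category.{v} C] {R : RestrictionStructure C}

theorem bar_id (X : C) : R.bar (𝟙 X) = 𝟙 X := by
  simpa using R.bar_comp_self (𝟙 X)

theorem bar_comp_bar_left {X Y Z : C} (f : X ⟶ Y) (g : Y ⟶ Z) :
    R.bar (f ≫ g) ≫ R.bar f = R.bar (f ≫ g) := by
  rw [R.bar_comm, ← R.bar_bar_comp, ← Category.assoc, R.bar_comp_self]

namespace IsPartialInverse

theorem symm {X Y : C} {f : X ⟶ Y} {g : Y ⟶ X} (h : R.IsPartialInverse f g) :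
    R.IsPartialInverse g f :=
  ⟨h.2, h.1⟩

protected theorem id (X : C) : R.IsPartialInverse (𝟙 X) (𝟙 X) := by
  constructor <;> rw [bar_id, Category.comp_id]

theorem bar_comp_eq {X Y : C} {f : X ⟶ Y} {g g' : Y ⟶ X} (h : R.IsPartialInverse f g)
    (h' : R.IsPartialInverse f g') : R.bar g ≫ g' = g := by
  rw [← h.1, Category.assoc, h'.2, ← h.2, ← Category.assoc, h.1, R.bar_comp_self]

theorem unique {X Y : C} {f : X ⟶ Y} {g g' : Y ⟶ X} (h : R.IsPartialInverse f g)
    (h' : R.IsPartialInverse f g') : g = g' :=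
  calc
    g = R.bar g ≫ R.bar g' ≫ g := by rw [h'.bar_comp_eq h, h.bar_comp_eq h']
    _ = R.bar g' ≫ g := by
      rw [← Category.assoc, R.bar_comm, Category.assoc, R.bar_comp_self]
    _ = g' := h'.bar_comp_eq h

theorem isPartialIso {X Y : C} {f : X ⟶ Y} {g : Y ⟶ X} (h : R.IsPartialInverse f g) :
    R.IsPartialIso f :=
  ⟨g, h, fun _ h' => h'.unique h⟩

/-- One of the two equations of `IsPartialInverse.comp`; the other is the same equation for the
inverses. -/
theorem comp_comp_comp_eq_bar {X Y Z : C} {f : X ⟶ Y} {f' : Y ⟶ X} {g : Y ⟶ Z} {g' : Z ⟶ Y}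
    (hf : R.IsPartialInverse f f') (hg : R.IsPartialInverse g g') :
    (f ≫ g) ≫ g' ≫ f' = R.bar (f ≫ g) :=
  calc
    (f ≫ g) ≫ g' ≫ f' = (f ≫ g ≫ g') ≫ f' := by simp only [Category.assoc]
    _ = R.bar (f ≫ g) ≫ R.bar f := by rw [hg.2, R.comp_bar, Category.assoc, hf.2]
    _ = R.bar (f ≫ g) := bar_comp_bar_left f g

theorem comp {X Y Z : C} {f : X ⟶ Y} {f' : Y ⟶ X} {g : Y ⟶ Z} {g' : Z ⟶ Y}
    (hf : R.IsPartialInverse f f') (hg : R.IsPartialInverse g g') :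
    R.IsPartialInverse (f ≫ g) (g' ≫ f') :=
  ⟨hg.symm.comp_comp_comp_eq_bar hf.symm, hf.comp_comp_comp_eq_bar hg⟩

end IsPartialInverse

theorem isPartialInverse_partialInverse (h : R.IsInverseCategory) {X Y : C} (f : X ⟶ Y) :
    R.IsPartialInverse f (partialInverse h f) :=
  (h f).choose_spec.1

theorem IsPartialInverse.partialInverse_eq (h : R.IsInverseCategory) {X Y : C} {f : X ⟶ Y}
    {g : Y ⟶ X} (hg : R.IsPartialInverse f g) : partialInverse h f = g :=
  (isPartialInverse_partialInverse h f).unique hg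

/-- The dagger structure `f ↦ f°` of an inverse category. -/
noncomputable def IsInverseCategory.dagger (h : R.IsInverseCategory) : DaggerStructure C where
  dag f := partialInverse h f
  dag_id X := (IsPartialInverse.id X).partialInverse_eq h
  dag_comp f g := ((isPartialInverse_partialInverse h f).comp
    (isPartialInverse_partialInverse h g)).partialInverse_eq h
  dag_dag f := (isPartialInverse_partialInverse h f).symm.partialInverse_eq h

end RestrictionStructure

/-! ### Partial maps with all morphisms as left legs -/

namespace Par

variable {C : Type u} [Category.{v} C] {M : MorphismProperty C} [hM : IsStableSystem M]

/-- The span `(m, f)` followed by `(f, m)` is the restriction idempotent `(m, m)`. -/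
theorem comp_swap {X Y : C} (S : PartialSpan M X Y) (h : M S.right) :
    comp (ofSpan S) (ofSpan ⟨S.dom, S.right, S.left, h⟩) = bar (ofSpan S) := by
  have := hM.mono h
  have sq : IsPullback (𝟙 S.dom) (𝟙 S.dom) S.right S.right := IsKernelPair.id_of_mono S.right
  refine (comp_ofSpan S (⟨S.dom, S.right, S.left, h⟩ : PartialSpan M Y X) sq).trans ?_
  exact ofSpan_eq (Iso.refl _) (by simp [compAlong]) (by simp [compAlong])

/-- A span both of whose legs lie in the stable system is inverted by exchanging its legs. -/
theorem isPartialInverse_swap {X Y : Par M} (S : PartialSpan M X.obj Y.obj) (h : M S.right) :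
    (restriction M).IsPartialInverse (X := X) (Y := Y) (ofSpan S)
      (ofSpan ⟨S.dom, S.right, S.left, h⟩) :=
  ⟨comp_swap ⟨S.dom, S.right, S.left, h⟩ S.left_mem, comp_swap S h⟩

theorem isInverseCategory_top (C : Type u) [Category.{v} C]
    [IsStableSystem (⊤ : MorphismProperty C)] :
    (restriction (⊤ : MorphismProperty C)).IsInverseCategory := by
  intro X Y f
  obtain ⟨S, rfl⟩ : ∃ S, ofSpan S = f := Quotient.exists_rep f
  exact (isPartialInverse_swap S trivial).isPartialIso

end Par

theorem mainTheorem8 :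
    -- Every inverse category is a dagger category, with dagger the partial inverse.
    (∀ (C : Type u) [Category.{v} C] (R : RestrictionStructure C) (h : R.IsInverseCategory),
      ∃ D : DaggerStructure C, ∀ {X Y : C} (f : X ⟶ Y),
        D.dag f = RestrictionStructure.partialInverse h f) ∧
    -- `Par((LocMeas, M), M)` is an inverse category, hence a dagger category.
    (∃ h : (Par.restriction (⊤ : MorphismProperty MonicLocMeas.{w})).IsInverseCategory,
      ∃ D : DaggerStructure ParMonicLocMeas.{w}, ∀ {X Y : ParMonicLocMeas.{w}} (f : X ⟶ Y),
        D.dag f = RestrictionStructure.partialInverse h f) :=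
  ⟨fun _ _ _ h => ⟨RestrictionStructure.IsInverseCategory.dagger h, fun _ => rfl⟩,
    Par.isInverseCategory_top _,
    RestrictionStructure.IsInverseCategory.dagger (Par.isInverseCategory_top _), fun _ => rfl⟩
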